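/- A quantum set $\mathcal X$ is given by a set $\mathrm{At}(\mathcal X)$ of nonzero finite-dimensional complex Hilbert spaces, called its atoms. A binary relation $R$ from $\mathcal X$ to $\mathcal Y$ assigns to each pair of atoms $X \in \mathrm{At}(\mathcal X)$, $Y \in \mathrm{At}(\mathcal Y)$ a linear subspace $R(X,Y)$ of the space $L(X,Y)$ of linear operators from $X$ to $Y$. Relations are ordered by atomwise inclusion and composed by $(S\circ R)(X,Z) = \mathrm{span}\{sr \mid Y\in \mathrm{At}(\mathcal Y),\ s\in S(Y,Z),\ r\in R(X,Y)\}$. The adjoint relation is $R^\dagger(Y,X) = \{r^\dagger \mid r\in R(X,Y)\}$, and the identity relation $I_{\mathcal X}$ has $I_{\mathcal X}(X,X)=\mathbb C\cdot 1_X$ and $I_{\mathcal X}(X,X')=0$ for $X\neq X'$. A function from $\mathcal X$ to $\mathcal Y$ is a relation $F$ with $F^\dagger\circ F\geq I_{\mathcal X}$ and $F\circ F^\dagger\leq I_{\mathcal Y}$; it is injective iff $F^\dagger\circ F\leq I_{\mathcal X}$ and surjective iff $F\circ F^\dagger\geq I_{\mathcal Y}$. Quantum sets and functions form a category $\mathbf{qSet}$.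 Let $\ell(\mathcal X)=\prod_{X\in\mathrm{At}(\mathcal X)}L(X)$, with the product topology, and let $\ell^\infty(\mathcal X)\subseteq\ell(\mathcal X)$ be the $*$-algebra of families with $\sup_X\|a(X)\|<\infty$, which is a von Neumann algebra of operators on the $\ell^2$-direct sum of the atoms of $\mathcal X$. A von Neumann algebra is hereditarily atomic iff in each of its von Neumann subalgebras every nonzero projection is above a minimal projection of that subalgebra; every $\ell^\infty(\mathcal X)$ is hereditarily atomic. Let $\mathbf M^*_1$ be the category of hereditarily atomic von Neumann algebras and unital normal $*$-homomorphisms. For a function $F$ from $\mathcal X$ to $\mathcal Y$, let $F^\star\colon\ell(\mathcal Y)\to\ell(\mathcal X)$ be the unique continuous unital $*$-homomorphism such that, for all $X\in\mathrm{At}(\mathcal X)$ and $Y\in\mathrm{At}(\mathcal Y)$, $F(X,Y)=\{v\in L(X,Y)\mid b(Y)\,v=v\,F^\star(b)(X)\text{ for all }b\in\ell(\mathcal Y)\}$; it restricts to a unital normal $*$-homomorphism $F^\star\colon\ell^\infty(\mathcal Y)\to\ell^\infty(\mathcal X)$. **Proposition.** Let $F$ be a function from a quantum set $\mathcal X$ to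 a quantum set $\mathcal Y$. (a) The following are equivalent: (1) $F$ is injective; (2) $F$ is monic in $\mathbf{qSet}$; (3) $F^\star$ is epic in $\mathbf M^*_1$; (4) $F^\star$ is surjective as a map $\ell^\infty(\mathcal Y)\to\ell^\infty(\mathcal X)$. (b) The following are equivalent: (1) $F$ is surjective; (2) $F$ is epic in $\mathbf{qSet}$; (3) $F^\star$ is monic in $\mathbf M^*_1$; (4) $F^\star$ is injective as a map $\ell^\infty(\mathcal Y)\to\ell^\infty(\mathcal X)$. -/

import Mathlib

universe u

/-- A quantum set, given by a set of atoms, each of which is a nonzero finite-dimensional complex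
Hilbert space.  The set of atoms is presented as a family with an index set `At`; two atoms are
regarded as equal iff their indices are equal. -/
structure QSet : Type (u + 1) where
  /-- the index set of the atoms -/
  At : Type u
  /-- the atoms -/
  atom : At → Type u
  /-- each atom is a Hilbert space -/
  [normed : ∀ i, NormedAddCommGroup (atom i)]
  [innerSpace : ∀ i, InnerProductSpace ℂ (atom i)]
  [finite : ∀ i, FiniteDimensional ℂ (atom i)]
  [nontriv : ∀ i, Nontrivial (atom i)]

attribute [instance] QSet.normed QSet.innerSpace QSet.finite QSet.nontriv

instance QSet.complete (X : QSet.{u}) (i : X.At) : CompleteSpace (X.atom i) :=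
  FiniteDimensional.complete ℂ (X.atom i)

/-- A binary relation from `X` to `Y`: a subspace of `L(X i, Y j)` for each pair of atoms
(all linear operators between atoms are continuous, since atoms are finite-dimensional).
The order on relations is the atomwise inclusion. -/
abbrev QRel (X Y : QSet.{u}) : Type u :=
  ∀ (i : X.At) (j : Y.At), Submodule ℂ (X.atom i →L[ℂ] Y.atom j)

namespace QRel

variable {W X Y Z : QSet.{u}}

/-- The identity relation: spanned by the identity operator on the diagonal, zero elsewhere. -/
def one (X : QSet.{u}) : QRel X X := fun i j =>
  Submodule.span ℂ {t | ∃ h : i = j, t = h ▸ ContinuousLinearMap.id ℂ (X.atom i)}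

/-- Composition of relations, `S ∘ R`. -/
def comp (S : QRel Y Z) (R : QRel X Y) : QRel X Z := fun i k =>
  Submodule.span ℂ {t | ∃ j, ∃ s ∈ S j k, ∃ r ∈ R i j, t = s.comp r}

/-- The adjoint relation `R†`, consisting of the Hermitian adjoints of the operators in `R`. -/
noncomputable def adj (R : QRel X Y) : QRel Y X := fun j i =>
  (R i j).map (ContinuousLinearMap.adjoint :
    (X.atom i →L[ℂ] Y.atom j) ≃ₗᵢ⋆[ℂ] (Y.atom j →L[ℂ] X.atom i)).toLinearEquiv.toLinearMap

/-- `R` is injective iff `R† ∘ R ≤ I`. -/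
def Injective (R : QRel X Y) : Prop := comp (adj R) R ≤ one X

/-- `R` is surjective iff `R ∘ R† ≥ I`. -/
def Surjective (R : QRel X Y) : Prop := one Y ≤ comp R (adj R)

/-- `R` is coinjective iff `R ∘ R† ≤ I`. -/
def Coinjective (R : QRel X Y) : Prop := comp R (adj R) ≤ one Y

/-- `R` is cosurjective iff `R† ∘ R ≥ I`. -/
def Cosurjective (R : QRel X Y) : Prop := one X ≤ comp (adj R) R

theorem mem_adj {R : QRel X Y} {j : Y.At} {i : X.At} {t : Y.atom j →L[ℂ] X.atom i} :
    t ∈ adj R j i ↔ t.adjoint ∈ R i j := by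
  constructor
  · rintro ⟨r, hr, rfl⟩
    simpa using! hr
  · intro h
    exact ⟨t.adjoint, h, by simp⟩

theorem comp_mem {S : QRel Y Z} {R : QRel X Y} {i j k} {s : Y.atom j →L[ℂ] Z.atom k}
    {r : X.atom i →L[ℂ] Y.atom j} (hs : s ∈ S j k) (hr : r ∈ R i j) :
    s.comp r ∈ comp S R i k :=
  Submodule.subset_span ⟨j, s, hs, r, hr, rfl⟩

theorem comp_le {S : QRel Y Z} {R : QRel X Y} {T : QRel X Z} :
    comp S R ≤ T ↔ ∀ i j k, ∀ s ∈ S j k, ∀ r ∈ R i j, s.comp r ∈ T i k := by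
  constructor
  · intro h i j k s hs r hr
    exact h i k (comp_mem hs hr)
  · intro h i k
    refine Submodule.span_le.2 ?_
    rintro _ ⟨j, s, hs, r, hr, rfl⟩
    exact h i j k s hs r hr

theorem comp_mono {S S' : QRel Y Z} {R R' : QRel X Y} (hS : S ≤ S') (hR : R ≤ R') :
    comp S R ≤ comp S' R' :=
  comp_le.2 fun _ _ _ _ hs _ hr => comp_mem (hS _ _ hs) (hR _ _ hr)

theorem id_mem_one (i : X.At) : ContinuousLinearMap.id ℂ (X.atom i) ∈ one X i i :=
  Submodule.subset_span ⟨rfl, rfl⟩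

theorem one_le {T : QRel X X} :
    one X ≤ T ↔ ∀ i, ContinuousLinearMap.id ℂ (X.atom i) ∈ T i i := by
  constructor
  · intro h i
    exact h i i (id_mem_one i)
  · intro h i j
    refine Submodule.span_le.2 ?_
    rintro _ ⟨rfl, rfl⟩
    exact h i

theorem mem_one_self {i : X.At} {t : X.atom i →L[ℂ] X.atom i} :
    t ∈ one X i i ↔ ∃ c : ℂ, t = c • ContinuousLinearMap.id ℂ (X.atom i) := by
  have h : one X i i = Submodule.span ℂ {ContinuousLinearMap.id ℂ (X.atom i)} := by
    unfold one
    congr 1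
    ext t; simp
  simp only [h, Submodule.mem_span_singleton, eq_comm]

theorem mem_one_ne {i j : X.At} (h : i ≠ j) {t : X.atom i →L[ℂ] X.atom j} :
    t ∈ one X i j ↔ t = 0 := by
  have h' : one X i j = Submodule.span ℂ ∅ := by
    unfold one
    congr 1
    ext t; simp [h]
  simp [h']

theorem comp_assoc (T : QRel Y Z) (S : QRel X Y) (R : QRel W X) :
    comp (comp T S) R = comp T (comp S R) := by
  apply le_antisymm
  · refine comp_le.2 fun i j l s hs r hr => ?_
    induction hs using Submodule.span_induction with
    | mem s hs =>
      obtain ⟨k, t, ht, s, hs, rfl⟩ := hs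
      exact comp_mem ht (comp_mem hs hr)
    | zero => simp
    | add x y _ _ hx hy => simpa using add_mem hx hy
    | smul a x _ hx => simpa using Submodule.smul_mem _ a hx
  · refine comp_le.2 fun i k l t ht r hr => ?_
    induction hr using Submodule.span_induction with
    | mem s hs =>
      obtain ⟨k, s, hs, r, hr, rfl⟩ := hs
      exact comp_mem (comp_mem ht hs) hr
    | zero => simp
    | add x y _ _ hx hy => simpa using add_mem hx hy
    | smul a x _ hx => simpa using Submodule.smul_mem _ a hx

theorem one_comp (R : QRel X Y) : comp (one Y) R = R := by
  apply le_antisymm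
  · refine comp_le.2 fun i j k s hs r hr => ?_
    by_cases h : j = k
    · subst h
      obtain ⟨c, rfl⟩ := mem_one_self.1 hs
      simpa using Submodule.smul_mem _ c hr
    · rw [(mem_one_ne h).1 hs]
      simp
  · intro i j r hr
    exact comp_mem (id_mem_one j) hr

theorem comp_one (R : QRel X Y) : comp R (one X) = R := by
  apply le_antisymm
  · refine comp_le.2 fun i j k s hs r hr => ?_
    by_cases h : i = j
    · subst h
      obtain ⟨c, rfl⟩ := mem_one_self.1 hr
      simpa using Submodule.smul_mem _ c hs
    · rw [(mem_one_ne h).1 hr]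
      simp
  · intro i j r hr
    exact comp_mem hr (id_mem_one i)

theorem adj_one : adj (one X) = one X := by
  funext j i
  ext t
  rw [mem_adj]
  by_cases h : i = j
  · subst h
    rw [mem_one_self, mem_one_self]
    constructor
    · rintro ⟨c, hc⟩
      refine ⟨star c, ?_⟩
      rw [← ContinuousLinearMap.adjoint_adjoint t, hc, map_smulₛₗ, ContinuousLinearMap.adjoint_id]
      rfl
    · rintro ⟨c, rfl⟩
      exact ⟨star c, by rw [map_smulₛₗ, ContinuousLinearMap.adjoint_id]; rfl⟩
  · rw [mem_one_ne h, mem_one_ne (Ne.symm h)]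
    simp

theorem adj_comp (S : QRel Y Z) (R : QRel X Y) :
    adj (comp S R) = comp (adj R) (adj S) := by
  apply le_antisymm
  · intro k i t ht
    rw [mem_adj] at ht
    have key : ∀ w ∈ comp S R i k, ContinuousLinearMap.adjoint w ∈ comp (adj R) (adj S) k i := by
      intro w hw
      induction hw using Submodule.span_induction with
      | mem s hs =>
        obtain ⟨j, s, hs, r, hr, rfl⟩ := hs
        rw [ContinuousLinearMap.adjoint_comp]
        exact comp_mem (mem_adj.2 (by simpa using hr)) (mem_adj.2 (by simpa using hs))
      | zero => simp
      | add x y _ _ hx hy => simpa using add_mem hx hy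
      | smul a x _ hx => rw [map_smulₛₗ]; exact Submodule.smul_mem _ _ hx
    simpa using key _ ht
  · refine comp_le.2 fun k j i r hr s hs => ?_
    rw [mem_adj] at hr hs ⊢
    rw [ContinuousLinearMap.adjoint_comp]
    exact comp_mem hs hr

end QRel

/-- A function from `X` to `Y`: a relation `F` with `F† ∘ F ≥ I` and `F ∘ F† ≤ I`. -/
@[ext]
structure QFun (X Y : QSet.{u}) : Type u where
  /-- the underlying relation -/
  rel : QRel X Y
  cosurj : rel.Cosurjective
  coinj : rel.Coinjective

/-- The category `qSet` of quantum sets and functions, with composition of relations. -/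
noncomputable instance QSet.category : CategoryTheory.Category.{u} QSet.{u} where
  Hom X Y := QFun X Y
  id X :=
    { rel := QRel.one X
      cosurj := by rw [QRel.Cosurjective, QRel.adj_one, QRel.comp_one]
      coinj := by rw [QRel.Coinjective, QRel.adj_one, QRel.comp_one] }
  comp F G :=
    { rel := QRel.comp G.rel F.rel
      cosurj := by
        have h := QRel.comp_mono (le_refl (QRel.adj F.rel))
          (QRel.comp_mono G.cosurj (le_refl F.rel))
        rw [QRel.one_comp] at h
        rw [QRel.Cosurjective, QRel.adj_comp, QRel.comp_assoc, ← QRel.comp_assoc _ G.rel]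
        exact le_trans F.cosurj h
      coinj := by
        have h := QRel.comp_mono (le_refl G.rel)
          (QRel.comp_mono F.coinj (le_refl (QRel.adj G.rel)))
        rw [QRel.one_comp] at h
        rw [QRel.Coinjective, QRel.adj_comp, QRel.comp_assoc, ← QRel.comp_assoc F.rel]
        exact le_trans h G.coinj }
  id_comp F := QFun.ext (QRel.comp_one _)
  comp_id F := QFun.ext (QRel.one_comp _)
  assoc F G H := QFun.ext (QRel.comp_assoc _ _ _).symm

namespace QSet

/-- `ℓ(X)`, the `*`-algebra of all families of operators on the atoms of `X`. -/
abbrev Ell (X : QSet.{u}) : Type u := ∀ i : X.At, X.atom i →L[ℂ] X.atom i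

/-- `ℓ^∞(X)`, the `*`-algebra of all uniformly bounded families of operators on the atoms. -/
abbrev EllInf (X : QSet.{u}) : Type u :=
  lp (fun i : X.At => X.atom i →L[ℂ] X.atom i) (⊤ : ENNReal)

end QSet

namespace QFun

variable {X Y : QSet.{u}}

/-- The identity of each atom of `X` is a finite sum of operators `v† w` with `v, w` in `F`. -/
theorem exists_decomp (F : QFun X Y) (i : X.At) :
    ∃ (κ : Type) (_ : Fintype κ) (j : κ → Y.At)
      (v w : ∀ k, X.atom i →L[ℂ] Y.atom (j k)), (∀ k, v k ∈ F.rel i (j k)) ∧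
      (∀ k, w k ∈ F.rel i (j k)) ∧
      ContinuousLinearMap.id ℂ (X.atom i) = ∑ k, (v k).adjoint.comp (w k) := by
  have h := QRel.one_le.1 F.cosurj i
  generalize ContinuousLinearMap.id ℂ (X.atom i) = t at h ⊢
  induction h using Submodule.span_induction with
  | mem t ht =>
    obtain ⟨j, s, hs, r, hr, rfl⟩ := ht
    refine ⟨Unit, inferInstance, fun _ => j, fun _ => s.adjoint, fun _ => r,
      fun _ => QRel.mem_adj.1 hs, fun _ => hr, ?_⟩
    simp
  | zero => exact ⟨Empty, inferInstance, Empty.elim, fun k => k.elim, fun k => k.elim,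
      fun k => k.elim, fun k => k.elim, by simp⟩
  | add x y _ _ hx hy =>
    obtain ⟨κ, _, j, v, w, hv, hw, rfl⟩ := hx
    obtain ⟨κ', _, j', v', w', hv', hw', rfl⟩ := hy
    refine ⟨κ ⊕ κ', inferInstance, Sum.elim j j', Sum.rec v v', Sum.rec w w', ?_, ?_, ?_⟩
    · rintro (k | k)
      · exact hv k
      · exact hv' k
    · rintro (k | k)
      · exact hw k
      · exact hw' k
    · rw [Fintype.sum_sum_type]
      rfl
  | smul a x _ hx =>
    obtain ⟨κ, _, j, v, w, hv, hw, rfl⟩ := hx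
    refine ⟨κ, inferInstance, j, v, fun k => a • w k, hv,
      fun k => Submodule.smul_mem _ _ (hw k), ?_⟩
    simp [Finset.smul_sum]

theorem eq_sum {i : X.At} {κ : Type} [Fintype κ] {j : κ → Y.At}
    {v w : ∀ k, X.atom i →L[ℂ] Y.atom (j k)}
    (hd : ContinuousLinearMap.id ℂ (X.atom i) = ∑ k, (v k).adjoint.comp (w k))
    (F : QFun X Y) (hw : ∀ k, w k ∈ F.rel i (j k)) {b : Y.Ell}
    {a : X.atom i →L[ℂ] X.atom i} (ha : ∀ j, ∀ u ∈ F.rel i j, (b j).comp u = u.comp a) :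
    a = ∑ k, (v k).adjoint.comp ((b (j k)).comp (w k)) := by
  calc a = (ContinuousLinearMap.id ℂ (X.atom i)).comp a := by simp
    _ = _ := by
      rw [hd, ContinuousLinearMap.finsetSum_comp]
      refine Finset.sum_congr rfl fun k _ => ?_
      rw [ha _ _ (hw k), ContinuousLinearMap.comp_assoc]

theorem existsUnique_pullback (F : QFun X Y) (b : Y.Ell) (i : X.At) :
    ∃! a : X.atom i →L[ℂ] X.atom i, ∀ j, ∀ v ∈ F.rel i j, (b j).comp v = v.comp a := by
  obtain ⟨κ, _, j, v, w, hv, hw, hd⟩ := F.exists_decomp i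
  refine ⟨∑ k, (v k).adjoint.comp ((b (j k)).comp (w k)), ?_, fun a ha => eq_sum hd F hw ha⟩
  intro l u hu
  have key : ∀ k, u.comp ((v k).adjoint.comp ((b (j k)).comp (w k))) =
      (b l).comp (u.comp ((v k).adjoint.comp (w k))) := by
    intro k
    have hc : u.comp (v k).adjoint ∈ QRel.one Y (j k) l :=
      F.coinj _ _ (QRel.comp_mem hu (QRel.mem_adj.2 (by simpa using hv k)))
    simp only [← ContinuousLinearMap.comp_assoc]
    obtain h | h := eq_or_ne (j k) l
    · subst h
      obtain ⟨c, hc⟩ := QRel.mem_one_self.1 hc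
      have e : (b (j k)).comp (u.comp (v k).adjoint) = (u.comp (v k).adjoint).comp (b (j k)) := by
        rw [hc]
        ext x
        simp
      rw [← e]
      rfl
    · rw [(QRel.mem_one_ne h).1 hc]
      have e : ((b l).comp u).comp (v k).adjoint = (b l).comp (u.comp (v k).adjoint) := rfl
      rw [e, (QRel.mem_one_ne h).1 hc]
      simp
  rw [ContinuousLinearMap.comp_finsetSum, Finset.sum_congr rfl fun k _ => key k,
    ← ContinuousLinearMap.comp_finsetSum, ← ContinuousLinearMap.comp_finsetSum, ← hd]
  simp

/-- The component at the atom `i` of `F^⋆(b)`: the unique operator `a` on this atom with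
`b(j) v = v a` for every atom `j` of `Y` and every operator `v` in `F(i, j)`. -/
noncomputable def pullbackAt (F : QFun X Y) (b : Y.Ell) (i : X.At) : X.atom i →L[ℂ] X.atom i :=
  (F.existsUnique_pullback b i).choose

theorem pullbackAt_spec (F : QFun X Y) (b : Y.Ell) (i : X.At) (j : Y.At)
    (v : X.atom i →L[ℂ] Y.atom j) (hv : v ∈ F.rel i j) :
    (b j).comp v = v.comp (F.pullbackAt b i) :=
  (F.existsUnique_pullback b i).choose_spec.1 j v hv

theorem pullbackAt_unique {F : QFun X Y} {b : Y.Ell} {i : X.At} {a : X.atom i →L[ℂ] X.atom i}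
    (ha : ∀ j, ∀ v ∈ F.rel i j, (b j).comp v = v.comp a) : F.pullbackAt b i = a :=
  ((F.existsUnique_pullback b i).choose_spec.2 a ha).symm

/-- The unital `*`-homomorphism `F^⋆ : ℓ(Y) → ℓ(X)`.  It is the continuous `*`-homomorphism that
corresponds to `F` under the bijection sending a continuous `*`-homomorphism `φ` to the relation
`F(i, j) = {v | b(j) v = v φ(b)(i) for all b}`; see `continuous_pullback` and `mem_rel_iff`. -/
noncomputable def pullback (F : QFun X Y) : Y.Ell →⋆ₐ[ℂ] X.Ell where
  toFun b i := F.pullbackAt b i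
  map_one' := by
    funext i
    refine pullbackAt_unique fun j v hv => ?_
    ext x; simp
  map_mul' b c := by
    funext i
    refine pullbackAt_unique fun j v hv => ?_
    change (b j).comp ((c j).comp v) = (v.comp (F.pullbackAt b i)).comp (F.pullbackAt c i)
    rw [F.pullbackAt_spec c i j v hv, ← F.pullbackAt_spec b i j v hv]
    rfl
  map_zero' := by
    funext i
    refine pullbackAt_unique fun j v hv => ?_
    ext x; simp
  map_add' b c := by
    funext i
    refine pullbackAt_unique fun j v hv => ?_
    simp only [Pi.add_apply, ContinuousLinearMap.add_comp, ContinuousLinearMap.comp_add]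
    rw [F.pullbackAt_spec c i j v hv, F.pullbackAt_spec b i j v hv]
  commutes' r := by
    funext i
    refine pullbackAt_unique fun j v hv => ?_
    ext x; simp [Algebra.algebraMap_eq_smul_one]
  map_star' b := by
    funext i
    obtain ⟨κ, _, j, v, w, hv, hw, hd⟩ := F.exists_decomp i
    have hd' : ContinuousLinearMap.id ℂ (X.atom i) = ∑ k, (w k).adjoint.comp (v k) := by
      have := congrArg ContinuousLinearMap.adjoint hd
      rw [ContinuousLinearMap.adjoint_id, map_sum] at this
      simpa [ContinuousLinearMap.adjoint_comp] using this
    rw [eq_sum hd' F hv (F.pullbackAt_spec (star b) i)]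
    change _ = ContinuousLinearMap.adjoint (F.pullbackAt b i)
    rw [eq_sum hd F hw (F.pullbackAt_spec b i), map_sum]
    simp only [ContinuousLinearMap.adjoint_comp, ContinuousLinearMap.adjoint_adjoint]
    rfl

theorem pullback_spec (F : QFun X Y) (b : Y.Ell) {i : X.At} {j : Y.At}
    {v : X.atom i →L[ℂ] Y.atom j} (hv : v ∈ F.rel i j) :
    (b j).comp v = v.comp (F.pullback b i) :=
  F.pullbackAt_spec b i j v hv

/-- `F^⋆` is continuous for the product topologies. -/
theorem continuous_pullback (F : QFun X Y) : Continuous F.pullback := by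
  refine continuous_pi fun i => ?_
  obtain ⟨κ, _, j, v, w, hv, hw, hd⟩ := F.exists_decomp i
  have e : (fun b => F.pullback b i) =
      fun b : Y.Ell => ∑ k, (v k).adjoint.comp ((b (j k)).comp (w k)) :=
    funext fun b => eq_sum hd F hw fun j u hu => F.pullback_spec b hu
  rw [e]
  fun_prop

/-- `F` is recovered from `F^⋆` as the relation of all intertwining operators. -/
theorem mem_rel_iff (F : QFun X Y) {i : X.At} {j : Y.At} {v : X.atom i →L[ℂ] Y.atom j} :
    v ∈ F.rel i j ↔ ∀ b : Y.Ell, (b j).comp v = v.comp (F.pullback b i) := by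
  classical
  refine ⟨fun hv b => F.pullback_spec b hv, fun h => ?_⟩
  obtain ⟨κ, _, l, u, w, hu, hw, hd⟩ := F.exists_decomp i
  have e : v = ∑ k, (v.comp (u k).adjoint).comp (w k) := by
    conv_lhs => rw [← ContinuousLinearMap.comp_id v, hd, ContinuousLinearMap.comp_finsetSum]
    rfl
  have comm : ∀ (b : Y.Ell) k,
      (b j).comp (v.comp (u k).adjoint) = (v.comp (u k).adjoint).comp (b (l k)) := by
    intro b k
    have h1 := congrArg ContinuousLinearMap.adjoint (F.pullback_spec (star b) (hu k))
    rw [map_star, ContinuousLinearMap.adjoint_comp, ContinuousLinearMap.adjoint_comp] at h1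
    have h2 : (u k).adjoint.comp (b (l k)) = (F.pullback b i).comp (u k).adjoint := by
      simpa [ContinuousLinearMap.star_eq_adjoint] using h1
    calc (b j).comp (v.comp (u k).adjoint) = ((b j).comp v).comp (u k).adjoint := rfl
      _ = v.comp ((F.pullback b i).comp (u k).adjoint) := by rw [h b]; rfl
      _ = _ := by rw [← h2]; rfl
  rw [e]
  refine Submodule.sum_mem _ fun k _ => ?_
  have hk := hw k
  have ck := fun b => comm b k
  revert hk ck
  generalize u k = u'
  generalize w k = w'
  revert u' w'
  generalize l k = m
  intro u' w' hk ck
  by_cases hm : m = j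
  · subst hm
    have hcen : v.comp u'.adjoint ∈ Subalgebra.center ℂ (Y.atom m →L[ℂ] Y.atom m) := by
      rw [Subalgebra.mem_center_iff]
      intro b
      simpa using! ck (Pi.single m b)
    rw [Algebra.IsCentral.center_eq_bot] at hcen
    obtain ⟨c, hc⟩ := Algebra.mem_bot.1 hcen
    rw [← hc, Algebra.algebraMap_eq_smul_one]
    exact Submodule.smul_mem _ c hk
  · have := ck (Pi.single m (ContinuousLinearMap.id ℂ _))
    rw [Pi.single_eq_of_ne (Ne.symm hm), Pi.single_eq_same] at this
    rw [ContinuousLinearMap.comp_id, ContinuousLinearMap.zero_comp] at this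
    rw [← this]
    simp

/-- The inclusion of `ℓ^∞(X)` in `ℓ(X)`. -/
noncomputable def _root_.QSet.incl (X : QSet.{u}) : X.EllInf →⋆ₐ[ℂ] X.Ell where
  toFun a := a
  map_one' := rfl
  map_mul' _ _ := rfl
  map_zero' := rfl
  map_add' _ _ := rfl
  commutes' _ := rfl
  map_star' _ := rfl

theorem norm_pullback_le (F : QFun X Y) (b : Y.EllInf) (i : X.At) :
    ‖F.pullback b i‖ ≤ ‖b‖ := by
  let φ : Y.EllInf →⋆ₐ[ℂ] (X.atom i →L[ℂ] X.atom i) :=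
    (Pi.evalStarAlgHom ℂ (fun i : X.At => X.atom i →L[ℂ] X.atom i) i).comp
      (F.pullback.comp Y.incl)
  exact NonUnitalStarAlgHom.norm_apply_le φ b

/-- The restriction of `F^⋆` to a `*`-homomorphism `ℓ^∞(Y) → ℓ^∞(X)`. -/
noncomputable def pullbackInf (F : QFun X Y) : Y.EllInf →⋆ₐ[ℂ] X.EllInf where
  toFun b := ⟨F.pullback b, memℓp_infty ⟨‖b‖, by
    rintro _ ⟨i, rfl⟩
    exact F.norm_pullback_le b i⟩⟩
  map_one' := Subtype.ext (map_one F.pullback)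
  map_mul' b c := Subtype.ext (map_mul F.pullback (Y.incl b) (Y.incl c))
  map_zero' := Subtype.ext (map_zero F.pullback)
  map_add' b c := Subtype.ext (map_add F.pullback (Y.incl b) (Y.incl c))
  commutes' r := Subtype.ext (AlgHomClass.commutes F.pullback r)
  map_star' b := Subtype.ext (map_star F.pullback (Y.incl b))

end QFun

namespace VonNeumannAlgebra

variable {H : Type u} [NormedAddCommGroup H] [InnerProductSpace ℂ H] [CompleteSpace H]

/-- `q` is a minimal projection of `B`: a nonzero projection in `B` such that each projection in
`B` below `q` is `0` or `q`. -/
def IsMinimalProjection (B : VonNeumannAlgebra H) (q : H →L[ℂ] H) : Prop :=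
  q ∈ B ∧ IsStarProjection q ∧ q ≠ 0 ∧
    ∀ r ∈ B, IsStarProjection r → r ≤ q → r = 0 ∨ r = q

/-- `B` is atomic: every nonzero projection in `B` is above a minimal projection of `B`. -/
def IsAtomic (B : VonNeumannAlgebra H) : Prop :=
  ∀ p ∈ B, IsStarProjection p → p ≠ 0 → ∃ q, B.IsMinimalProjection q ∧ q ≤ p

/-- `A` is hereditarily atomic: every von Neumann subalgebra of `A` is atomic. -/
def IsHereditarilyAtomic (A : VonNeumannAlgebra H) : Prop :=
  ∀ B : VonNeumannAlgebra H, B ≤ A → B.IsAtomic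

end VonNeumannAlgebra

/-- A hereditarily atomic von Neumann algebra, acting on a complex Hilbert space. -/
structure MStar : Type (u + 1) where
  /-- the Hilbert space -/
  space : Type u
  [normed : NormedAddCommGroup space]
  [innerSpace : InnerProductSpace ℂ space]
  [complete : CompleteSpace space]
  /-- the von Neumann algebra -/
  algebra : VonNeumannAlgebra space
  hereditarilyAtomic : algebra.IsHereditarilyAtomic

attribute [instance] MStar.normed MStar.innerSpace MStar.complete

namespace MStar

/-- The underlying `*`-algebra, partially ordered as a set of operators. -/
abbrev Carrier (A : MStar.{u}) : Type u := A.algebra.toStarSubalgebra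

/-- A map between von Neumann algebras is normal iff it preserves the suprema of nonempty
upward directed sets of self-adjoint operators, whenever these suprema exist. -/
def IsNormal {A B : MStar.{u}} (φ : A.Carrier → B.Carrier) : Prop :=
  ∀ (D : Set A.Carrier) (s : A.Carrier), D.Nonempty → (∀ d ∈ D, IsSelfAdjoint d) →
    DirectedOn (· ≤ ·) D → IsLUB D s → IsLUB (φ '' D) (φ s)

/-- A unital normal `*`-homomorphism. -/
@[ext]
structure Hom (A B : MStar.{u}) : Type u where
  /-- the underlying unital `*`-homomorphism -/
  toStarAlgHom : A.Carrier →⋆ₐ[ℂ] B.Carrier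
  normal : IsNormal toStarAlgHom

theorem le_iff {A : MStar.{u}} {a b : A.Carrier} :
    a ≤ b ↔ ((b : A.space →L[ℂ] A.space) - a).IsPositive := Iff.rfl

end MStar

namespace MStar

theorem IsNormal.mono {A B : MStar.{u}} {φ : A.Carrier → B.Carrier} (h : IsNormal φ)
    {a b : A.Carrier} (ha : IsSelfAdjoint a) (hb : IsSelfAdjoint b) (hab : a ≤ b) :
    φ a ≤ φ b := by
  have hl : IsLUB {a, b} b := by
    refine ⟨?_, fun c hc => hc (by simp)⟩
    rintro c (rfl | rfl)
    · exact hab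
    · exact le_rfl
  have := h {a, b} b ⟨a, by simp⟩ (by rintro d (rfl | rfl) <;> assumption)
    (by
      intro x hx y hy
      exact ⟨b, by simp, hl.1 hx, hl.1 hy⟩) hl
  exact this.1 ⟨a, by simp, rfl⟩

/-- The category of hereditarily atomic von Neumann algebras and unital normal
`*`-homomorphisms. -/
noncomputable instance category : CategoryTheory.Category.{u} MStar.{u} where
  Hom A B := Hom A B
  id A := ⟨StarAlgHom.id ℂ A.Carrier, fun D s _ _ _ h => by simpa using! h⟩
  comp φ ψ := ⟨ψ.toStarAlgHom.comp φ.toStarAlgHom, fun D s hne hsa hdir h => by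
    have h1 := φ.normal D s hne hsa hdir h
    have h2 := ψ.normal (φ.toStarAlgHom '' D) _ (hne.image _)
      (by
        rintro _ ⟨d, hd, rfl⟩
        exact (hsa d hd).map φ.toStarAlgHom)
      (by
        rintro _ ⟨x, hx, rfl⟩ _ ⟨y, hy, rfl⟩
        obtain ⟨z, hz, hxz, hyz⟩ := hdir x hx y hy
        exact ⟨_, ⟨z, hz, rfl⟩, φ.normal.mono (hsa x hx) (hsa z hz) hxz,
          φ.normal.mono (hsa y hy) (hsa z hz) hyz⟩) h1
    rw [Set.image_image] at h2
    exact h2⟩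
  id_comp _ := rfl
  comp_id _ := rfl
  assoc _ _ _ := rfl

end MStar

namespace QSet

variable (X : QSet.{u})

/-- The `ℓ²`-direct sum of the atoms of `X`. -/
abbrev EllTwo : Type u := lp X.atom 2

variable {X}

theorem norm_proj_le (a : X.EllInf) (i : X.At) : ‖a i‖ ≤ ‖a‖ :=
  lp.norm_apply_le_norm ENNReal.top_ne_zero a i

/-- The block diagonal operator on the `ℓ²`-direct sum given by a bounded family. -/
noncomputable def diag (a : X.EllInf) : X.EllTwo →L[ℂ] X.EllTwo :=
  lp.mapCLM 2 (fun i => a i) (norm_nonneg a) (norm_proj_le a)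

@[simp]
theorem diag_apply (a : X.EllInf) (f : X.EllTwo) (i : X.At) : diag a f i = a i (f i) := rfl

/-- The canonical representation of `ℓ^∞(X)` by block diagonal operators. -/
noncomputable def rep (X : QSet.{u}) : X.EllInf →⋆ₐ[ℂ] (X.EllTwo →L[ℂ] X.EllTwo) where
  toFun a := diag a
  map_one' := rfl
  map_mul' _ _ := rfl
  map_zero' := rfl
  map_add' _ _ := rfl
  commutes' r := by
    ext f i
    rfl
  map_star' a := by
    rw [ContinuousLinearMap.star_eq_adjoint, ContinuousLinearMap.eq_adjoint_iff]
    intro f g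
    rw [lp.inner_eq_tsum, lp.inner_eq_tsum]
    refine tsum_congr fun i => ?_
    change inner ℂ (ContinuousLinearMap.adjoint (a i) (f i)) (g i) = inner ℂ (f i) (a i (g i))
    rw [ContinuousLinearMap.adjoint_inner_left]

theorem rep_apply (a : X.EllInf) (f : X.EllTwo) (i : X.At) : X.rep a f i = a i (f i) := rfl

open Classical in
/-- The inclusion of an atom into the `ℓ²`-direct sum. -/
noncomputable def emb (i : X.At) : X.atom i →L[ℂ] X.EllTwo :=
  LinearMap.mkContinuous (lp.lsingle (𝕜 := ℂ) 2 i) 1 fun x => by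
    rw [one_mul]
    exact (lp.norm_single (by norm_num) i x).le

theorem emb_self (i : X.At) (x : X.atom i) : emb i x i = x := by
  classical
  exact lp.single_apply_self 2 i x

theorem emb_ne {i j : X.At} (h : j ≠ i) (x : X.atom i) : emb i x j = 0 := by
  classical
  exact lp.single_apply_ne 2 i x h

/-- The coordinate projection of the `ℓ²`-direct sum onto an atom. -/
noncomputable def coord (i : X.At) : X.EllTwo →L[ℂ] X.atom i :=
  LinearMap.mkContinuous
    { toFun := fun f => f i
      map_add' := fun _ _ => rfl
      map_smul' := fun _ _ => rfl } 1 fun f => by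
    rw [one_mul]
    exact lp.norm_apply_le_norm (by norm_num) f i

theorem coord_apply (i : X.At) (f : X.EllTwo) : coord i f = f i := rfl

theorem rep_injective : Function.Injective X.rep := by
  intro a b h
  refine lp.ext (funext fun i => ContinuousLinearMap.ext fun x => ?_)
  have := congrArg (fun T : X.EllTwo →L[ℂ] X.EllTwo => T (emb i x) i) h
  simpa [rep_apply, emb_self] using this

/-- The family which is `c` at the atom `i` and zero at all other atoms. -/
noncomputable def block (i : X.At) (c : X.atom i →L[ℂ] X.atom i) : X.EllInf := by
  classical
  exact lp.single ⊤ i c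

theorem block_self (i : X.At) (c : X.atom i →L[ℂ] X.atom i) : block i c i = c := by
  classical
  exact lp.single_apply_self (E := fun i => X.atom i →L[ℂ] X.atom i) ⊤ i c

theorem block_ne {i j : X.At} (h : j ≠ i) (c : X.atom i →L[ℂ] X.atom i) : block i c j = 0 := by
  classical
  exact lp.single_apply_ne (E := fun i => X.atom i →L[ℂ] X.atom i) ⊤ i c h

theorem rep_block (i : X.At) (c : X.atom i →L[ℂ] X.atom i) :
    X.rep (block i c) = (emb i).comp (c.comp (coord i)) := by
  ext f j
  rw [rep_apply]
  by_cases h : j = i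
  · subst h
    simp [block_self, emb_self, coord_apply]
  · simp [block_ne h, emb_ne h]

theorem mem_range_rep {T : X.EllTwo →L[ℂ] X.EllTwo}
    (hT : ∀ i, X.rep (block i 1) * T = T * X.rep (block i 1)) : T ∈ X.rep.range := by
  have hb : ∀ i f, T f i = T (emb i (f i)) i := by
    intro i f
    have h1 := congrArg (fun S : X.EllTwo →L[ℂ] X.EllTwo => S f i) (hT i)
    simpa [rep_block, coord_apply, emb_self] using! h1
  have hn : ∀ i, ‖(coord i).comp (T.comp (emb i))‖ ≤ ‖T‖ := by
    intro i
    refine ContinuousLinearMap.opNorm_le_bound _ (norm_nonneg _) fun x => ?_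
    calc ‖T (emb i x) i‖ ≤ ‖T (emb i x)‖ := lp.norm_apply_le_norm (by norm_num) _ i
      _ ≤ ‖T‖ * ‖emb i x‖ := T.le_opNorm _
      _ = ‖T‖ * ‖x‖ := by
        classical
        congr 1
        exact lp.norm_single (by norm_num) i x
  refine ⟨⟨fun i => (coord i).comp (T.comp (emb i)), memℓp_infty ⟨‖T‖, ?_⟩⟩, ?_⟩
  · rintro _ ⟨i, rfl⟩
    exact hn i
  · refine ContinuousLinearMap.ext fun f => lp.ext (funext fun i => ?_)
    exact (hb i f).symm

/-- `ℓ^∞(X)` as a von Neumann algebra of operators on the `ℓ²`-direct sum of the atoms. -/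
noncomputable def vonNeumann (X : QSet.{u}) : VonNeumannAlgebra X.EllTwo where
  toStarSubalgebra := X.rep.range
  centralizer_centralizer' := by
    refine Set.Subset.antisymm ?_ Set.subset_centralizer_centralizer
    intro T hT
    refine mem_range_rep fun i => ?_
    refine hT _ ?_
    rintro _ ⟨a, rfl⟩
    change X.rep a * X.rep (block i 1) = X.rep (block i 1) * X.rep a
    rw [← map_mul, ← map_mul]
    congr 1
    refine lp.ext (funext fun j => ?_)
    change a j * block i 1 j = block i 1 j * a j
    by_cases h : j = i
    · subst h
      rw [block_self, one_mul, mul_one]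
    · rw [block_ne h, zero_mul, mul_zero]

theorem mem_vonNeumann {T : X.EllTwo →L[ℂ] X.EllTwo} :
    T ∈ X.vonNeumann ↔ ∃ a, X.rep a = T := Iff.rfl

end QSet

namespace QSet

variable {X Y : QSet.{u}}

theorem coord_mul_congr {s f g} (hs : s ∈ X.vonNeumann) {i : X.At}
    (h : coord i f = coord i g) : coord i (s f) = coord i (s g) := by
  obtain ⟨a, rfl⟩ := mem_vonNeumann.1 hs
  change a i (coord i f) = a i (coord i g)
  rw [h]

/-- The supremum of all projections in `B` below `q` that vanish on the atom `i`. -/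
theorem exists_sup_vanishing (B : VonNeumannAlgebra X.EllTwo) {q : X.EllTwo →L[ℂ] X.EllTwo}
    (hq : IsStarProjection q) (i : X.At) :
    ∃ r ∈ B, IsStarProjection r ∧ r ≤ q ∧ (coord i).comp r = 0 ∧
      ∀ s ∈ B, IsStarProjection s → s ≤ q → (coord i).comp s = 0 → s ≤ r := by
  let S : Set (X.EllTwo →L[ℂ] X.EllTwo) :=
    {s | s ∈ B ∧ IsStarProjection s ∧ s ≤ q ∧ (coord i).comp s = 0}
  let W₀ : Submodule ℂ X.EllTwo := ⨆ s ∈ S, s.range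
  let W : Submodule ℂ X.EllTwo := W₀.topologicalClosure
  have hWc : IsClosed (W : Set X.EllTwo) := W₀.isClosed_topologicalClosure
  have : CompleteSpace W := hWc.completeSpace_coe
  have hr : IsStarProjection W.starProjection := isStarProjection_starProjection
  have hmin : ∀ K : Submodule ℂ X.EllTwo, IsClosed (K : Set X.EllTwo) →
      (∀ s ∈ S, ∀ f, s f ∈ K) → W ≤ K := by
    intro K hK h
    refine Submodule.topologicalClosure_minimal _ (iSup₂_le fun s hs => ?_) hK
    rintro _ ⟨f, rfl⟩
    exact h s hs f
  have hSW : ∀ s ∈ S, ∀ f, s f ∈ W := fun s hs f =>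
    W₀.le_topologicalClosure (Submodule.mem_iSup_of_mem s (Submodule.mem_iSup_of_mem hs ⟨f, rfl⟩))
  refine ⟨W.starProjection, ?_, hr, ?_, ?_, ?_⟩
  · refine (VonNeumannAlgebra.IsStarProjection.mem_iff hr B).2 fun y hy => ?_
    have e : W.starProjection.range = W := by simp
    rw [e, Module.End.mem_invtSubmodule]
    refine hmin _ (hWc.preimage y.continuous) fun s hs f => ?_
    have hc : s * y = y * s := VonNeumannAlgebra.mem_commutant_iff.1 hy s hs.1
    change y (s f) ∈ W
    have := hSW s hs (y f)
    rwa [← mul_apply_eq_comp, hc] at this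
  · rw [hr.le_iff_mul_eq_right hq]
    ext1 f
    have h : W ≤ (q - 1).ker := by
      refine hmin _ (q - 1).isClosed_ker fun s hs f => ?_
      have := (hs.2.1.le_iff_mul_eq_right hq).1 hs.2.2.1
      have h2 := congrArg (fun T : X.EllTwo →L[ℂ] X.EllTwo => T f) this
      simpa [sub_eq_zero] using h2
    have := h (W.starProjection_apply_mem f)
    simpa [sub_eq_zero] using this
  · have h : W ≤ (coord i).ker := by
      refine hmin _ (coord i).isClosed_ker fun s hs f => ?_
      exact congrArg (fun T : X.EllTwo →L[ℂ] X.atom i => T f) hs.2.2.2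
    ext1 f
    exact h (W.starProjection_apply_mem f)
  · intro s hs hsp hsq hsi
    rw [hsp.le_iff_mul_eq_right hr]
    ext1 f
    exact Submodule.starProjection_eq_self_iff.2 (hSW s ⟨hs, hsp, hsq, hsi⟩ f)

theorem hereditarilyAtomic (X : QSet.{u}) : X.vonNeumann.IsHereditarilyAtomic := by
  intro B hB p hp hpp hp0
  obtain ⟨i, hi⟩ : ∃ i, (coord i).comp p ≠ 0 := by
    by_contra! h
    refine hp0 (ContinuousLinearMap.ext fun f => lp.ext (funext fun i => ?_))
    exact congrArg (fun T : X.EllTwo →L[ℂ] X.atom i => T f) (h i)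
  let S : Set (X.EllTwo →L[ℂ] X.EllTwo) :=
    {s | s ∈ B ∧ IsStarProjection s ∧ s ≤ p ∧ (coord i).comp s ≠ 0}
  let n : (X.EllTwo →L[ℂ] X.EllTwo) → ℕ := fun s => Module.finrank ℂ ((coord i).comp s).range
  obtain ⟨q, ⟨hqB, hq, hqp, hqi⟩, hmin⟩ :=
    (measure n).wf.has_min S ⟨p, hp, hpp, le_rfl, hi⟩
  obtain ⟨r, hrB, hr, hrq, hri, hrmax⟩ := exists_sup_vanishing B hq i
  have hm : IsStarProjection (q - r) := (hr.le_iff_sub hq).1 hrq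
  have hmq : q - r ≤ q := by
    rw [hm.le_iff_mul_eq_right hq, mul_sub, hq.isIdempotentElem.eq,
      (hr.le_iff_mul_eq_right hq).1 hrq]
  refine ⟨q - r, ⟨sub_mem hqB hrB, hm, ?_, ?_⟩, hmq.trans hqp⟩
  · intro h
    apply hqi
    rw [sub_eq_zero.1 h, hri]
  · intro s hs hsp hsm
    have hsq : s ≤ q := hsm.trans hmq
    have e1 : (q - r) * s = s := (hsp.le_iff_mul_eq_right hm).1 hsm
    have e2 : q * s = s := (hsp.le_iff_mul_eq_right hq).1 hsq
    have e2' : s * q = s := (hsp.le_iff_mul_eq_left hq).1 hsq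
    rw [sub_mul, e2] at e1
    have e3 : r * s = 0 := by simpa using e1
    by_cases hsi : (coord i).comp s = 0
    · left
      rw [← (hsp.le_iff_mul_eq_right hr).1 (hrmax s hs hsp hsq hsi), e3]
    · right
      have hle : ((coord i).comp s).range ≤ ((coord i).comp q).range := by
        rintro _ ⟨f, rfl⟩
        refine ⟨s f, ?_⟩
        change coord i ((q * s) f) = coord i (s f)
        rw [e2]
      have hn : n q ≤ n s := not_lt.1 (hmin s ⟨hs, hsp, hsq.trans hqp, hsi⟩)
      have hrange := Submodule.eq_of_le_of_finrank_le hle hn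
      have hd : (coord i).comp (q - s) = 0 := by
        ext1 f
        have hf : ((coord i).comp q) f ∈ ((coord i).comp s).range := by
          rw [hrange]
          exact ⟨f, rfl⟩
        obtain ⟨g, hg⟩ := hf
        have hg' : coord i (s g) = coord i (q f) := hg
        have h1 := coord_mul_congr (hB hs) hg'
        rw [← mul_apply_eq_comp, ← mul_apply_eq_comp,
          hsp.isIdempotentElem.eq, e2', hg'] at h1
        change coord i (q f - s f) = 0
        rw [map_sub, h1, sub_self]
      have hqs : IsStarProjection (q - s) := (hsp.le_iff_sub hq).1 hsq
      have hqsq : q - s ≤ q := by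
        rw [hqs.le_iff_mul_eq_right hq, mul_sub, hq.isIdempotentElem.eq, e2]
      have h2 := (hqs.le_iff_mul_eq_right hr).1 (hrmax _ (sub_mem hqB hs) hqs hqsq hd)
      rw [mul_sub, (hr.le_iff_mul_eq_left hq).1 hrq, e3, sub_zero] at h2
      rw [h2]
      abel

/-- `ℓ^∞(X)` as an object of the category of hereditarily atomic von Neumann algebras. -/
noncomputable def toMStar (X : QSet.{u}) : MStar.{u} where
  space := X.EllTwo
  algebra := X.vonNeumann
  hereditarilyAtomic := X.hereditarilyAtomic

/-- The canonical identification of `ℓ^∞(X)` with its image under the block diagonal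
representation. -/
noncomputable def repEquiv (X : QSet.{u}) : X.EllInf ≃⋆ₐ[ℂ] X.toMStar.Carrier :=
  StarAlgEquiv.ofInjective X.rep rep_injective

theorem repEquiv_le_iff {a b : X.EllInf} :
    X.repEquiv a ≤ X.repEquiv b ↔ ∀ i, a i ≤ b i := by
  rw [MStar.le_iff]
  change (X.rep b - X.rep a).IsPositive ↔ _
  rw [← map_sub]
  constructor
  · intro h i
    rw [ContinuousLinearMap.le_def, ContinuousLinearMap.isPositive_iff_complex]
    intro x
    have := (ContinuousLinearMap.isPositive_iff_complex _).1 h (emb i x)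
    have e : inner ℂ (X.rep (b - a) (emb i x)) (emb i x) = inner ℂ ((b i - a i) x) x := by
      classical
      change inner ℂ (X.rep (b - a) (emb i x)) (lp.single 2 i x) = _
      rw [lp.inner_single_right, rep_apply, emb_self]
      rfl
    rwa [e] at this
  · intro h
    rw [ContinuousLinearMap.isPositive_iff_complex]
    intro f
    have hs : HasSum (fun i => inner ℂ ((b i - a i) (f i)) (f i))
        (inner ℂ (X.rep (b - a) f) f) := lp.hasSum_inner (X.rep (b - a) f) f
    have hp : ∀ i, ((inner ℂ ((b i - a i) (f i)) (f i) : ℂ).re : ℂ) =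
        inner ℂ ((b i - a i) (f i)) (f i) ∧ 0 ≤ (inner ℂ ((b i - a i) (f i)) (f i) : ℂ).re :=
      fun i => (ContinuousLinearMap.isPositive_iff_complex _).1 (h i) (f i)
    have hre := Complex.hasSum_re hs
    refine ⟨?_, hre.nonneg fun i => (hp i).2⟩
    have h2 := Complex.hasSum_ofReal.2 hre
    simp only [hp] at h2
    exact h2.unique hs

theorem le_iff_symm {a b : X.toMStar.Carrier} :
    a ≤ b ↔ ∀ i, X.repEquiv.symm a i ≤ X.repEquiv.symm b i := by
  rw [← repEquiv_le_iff]
  simp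

open Filter Topology in
/-- A directed set in `ℓ^∞(X)` with a supremum converges to this supremum at each atom. -/
theorem tendsto_of_isLUB {D : Set X.toMStar.Carrier} {s : X.toMStar.Carrier} (hne : D.Nonempty)
    (hdir : DirectedOn (· ≤ ·) D) (hs : IsLUB D s) (i : X.At) :
    Tendsto (fun d : D => X.repEquiv.symm d i) atTop (𝓝 (X.repEquiv.symm s i)) := by
  have : Nonempty D := hne.to_subtype
  have : IsDirectedOrder D := ⟨fun x y => by
    obtain ⟨z, hz, hxz, hyz⟩ := hdir x x.2 y y.2
    exact ⟨⟨z, hz⟩, hxz, hyz⟩⟩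
  have : ProperSpace (X.atom i →L[ℂ] X.atom i) := FiniteDimensional.proper ℂ _
  obtain ⟨d₀, hd₀⟩ := hne
  set σ := X.repEquiv.symm s with hσ
  let g : D → X.EllInf := fun d => X.repEquiv.symm d
  have hg : ∀ d e : D, d ≤ e → g d i ≤ g e i := fun d e h => le_iff_symm.1 h i
  have hgs : ∀ (d : D) j, g d j ≤ σ j := fun d => le_iff_symm.1 (hs.1 d.2)
  refine (isCompact_closedBall (g ⟨d₀, hd₀⟩ i)
    ‖σ i - g ⟨d₀, hd₀⟩ i‖).tendsto_nhds_of_unique_mapClusterPt ?_ ?_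
  · filter_upwards [eventually_ge_atTop (⟨d₀, hd₀⟩ : D)] with d hd
    rw [mem_closedBall_iff_norm]
    refine CStarAlgebra.norm_le_norm_of_nonneg_of_le (sub_nonneg.2 (hg _ _ hd)) ?_
    exact sub_le_sub_right (hgs d i) _
  · intro c _ hc
    obtain ⟨U, hU, hUc⟩ := mapClusterPt_iff_ultrafilter.1 hc
    have h1 : ∀ d : D, g d i ≤ c := fun d =>
      ge_of_tendsto hUc (((eventually_ge_atTop d).filter_mono hU).mono fun e he => hg d e he)
    have h2 : c ≤ σ i := le_of_tendsto hUc (Eventually.of_forall fun e => hgs e i)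
    refine le_antisymm h2 ?_
    let τ : X.EllInf := σ + block i (c - σ i)
    have hτi : τ i = c := by
      change σ i + block i (c - σ i) i = c
      rw [block_self]
      abel
    have hτj : ∀ j, j ≠ i → τ j = σ j := by
      intro j hj
      change σ j + block i (c - σ i) j = σ j
      rw [block_ne hj, add_zero]
    have h3 : s ≤ X.repEquiv τ := by
      refine hs.2 fun d hd => ?_
      rw [le_iff_symm, StarAlgEquiv.symm_apply_apply]
      intro j
      by_cases hj : j = i
      · subst hj
        rw [hτi]
        exact h1 ⟨d, hd⟩
      · rw [hτj j hj]
        exact hgs ⟨d, hd⟩ j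
    have h4 := le_iff_symm.1 h3 i
    rwa [StarAlgEquiv.symm_apply_apply, hτi] at h4

end QSet

namespace QFun

variable {X Y : QSet.{u}}

theorem pullback_mono (F : QFun X Y) {b c : Y.Ell} (h : ∀ j, b j ≤ c j) (i : X.At) :
    F.pullback b i ≤ F.pullback c i := by
  have h1 : ∀ j, ∃ a : Y.atom j →L[ℂ] Y.atom j, c j - b j = star a * a := fun j =>
    CStarAlgebra.nonneg_iff_eq_star_mul_self.1 (sub_nonneg.2 (h j))
  choose a ha using h1
  have h2 : c - b = star a * a := funext ha
  rw [← sub_nonneg]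
  change 0 ≤ (F.pullback c - F.pullback b) i
  rw [← map_sub, h2, map_mul, map_star]
  exact star_mul_self_nonneg (F.pullback a i)

/-- The map `F^⋆ : ℓ^∞(Y) → ℓ^∞(X)`, with both algebras represented as von Neumann algebras. -/
noncomputable def starAux (F : QFun X Y) : Y.toMStar.Carrier →⋆ₐ[ℂ] X.toMStar.Carrier :=
  ((X.repEquiv : X.EllInf →⋆ₐ[ℂ] X.toMStar.Carrier).comp F.pullbackInf).comp
    (Y.repEquiv.symm : Y.toMStar.Carrier →⋆ₐ[ℂ] Y.EllInf)

theorem symm_starAux (F : QFun X Y) (b : Y.toMStar.Carrier) (i : X.At) :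
    X.repEquiv.symm (F.starAux b) i = F.pullback (Y.repEquiv.symm b) i := by
  change X.repEquiv.symm (X.repEquiv (F.pullbackInf (Y.repEquiv.symm b))) i = _
  rw [StarAlgEquiv.symm_apply_apply]
  rfl

open Filter Topology in
theorem isNormal_starAux (F : QFun X Y) : MStar.IsNormal F.starAux := by
  intro D s hne _ hdir hs
  refine ⟨?_, ?_⟩
  · rintro _ ⟨d, hd, rfl⟩
    rw [QSet.le_iff_symm]
    intro i
    rw [symm_starAux, symm_starAux]
    exact F.pullback_mono (QSet.le_iff_symm.1 (hs.1 hd)) i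
  · intro t ht
    rw [QSet.le_iff_symm]
    intro i
    rw [symm_starAux]
    have : Nonempty D := hne.to_subtype
    have : IsDirectedOrder D := ⟨fun x y => by
      obtain ⟨z, hz, hxz, hyz⟩ := hdir x x.2 y y.2
      exact ⟨⟨z, hz⟩, hxz, hyz⟩⟩
    have h1 : Tendsto (fun (d : D) => (Y.repEquiv.symm d : Y.Ell)) atTop
        (𝓝 (Y.repEquiv.symm s : Y.Ell)) :=
      tendsto_pi_nhds.2 fun j => QSet.tendsto_of_isLUB hne hdir hs j
    have h2 := tendsto_pi_nhds.1 ((F.continuous_pullback.tendsto _).comp h1) i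
    refine le_of_tendsto h2 (Eventually.of_forall fun d => ?_)
    have h3 := QSet.le_iff_symm.1 (ht ⟨d, d.2, rfl⟩) i
    rwa [symm_starAux] at h3

/-- The unital normal `*`-homomorphism `F^⋆ : ℓ^∞(Y) → ℓ^∞(X)`, as a morphism of hereditarily
atomic von Neumann algebras. -/
noncomputable def starHom (F : QFun X Y) : Y.toMStar ⟶ X.toMStar :=
  (⟨F.starAux, F.isNormal_starAux⟩ : MStar.Hom _ _)

end QFun

/-! ### Scalars and unitaries between atoms. -/

namespace QRel

variable {X Y Z : QSet.{u}}

/-! Most implications are formal. An injective `F` has `F†` as a left inverse among relations, a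
surjective one as a right inverse, so they are monic and epic. The assignment `F ↦ F^⋆` is
contravariant and faithful (`starHom_comp`, `starHom_injective`), so it reflects epis to monos and
monos to epis. If `F` is injective, each nonzero operator in `F` is a multiple of a unitary, so
bounded families on `X` can be transported to `Y` (`surjective_pullbackInf`).

The substance lies in recovering (1) from (2). An operator in `(F† ∘ F)(i, k)` intertwines the
actions of `ℓ(Y)` on the atoms `i` and `k`. A unitary intertwiner yields two functions from a
one-atom quantum set to `X` which agree after composition with `F`, so monicity forces it into the
identity relation. The self-intertwiners of an atom form a finite-dimensional C*-algebra, spanned by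
its unitaries, and hence are scalars. For an arbitrary intertwiner `t`, both `t† t` and `t t†` are
then scalar, so `t` is zero or a multiple of a unitary, and the unitary case applies
(`injective_of_mono`).

For epis, if `F` has only zero operators into an atom `j`, two maps from `Y` to its double that
differ only at `j` agree after `F` (`surjective_of_epi`). -/

theorem mul_eq_mul_of_mem_one {i k : X.At} {t : X.atom i →L[ℂ] X.atom k} (ht : t ∈ one X i k)
    (a : X.Ell) : (a k).comp t = t.comp (a i) := by
  obtain rfl | h := eq_or_ne i k
  · obtain ⟨c, rfl⟩ := mem_one_self.1 ht
    ext x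
    simp
  · rw [(mem_one_ne h).1 ht]
    simp

/-- An operator `t` for which `t† t` and `t t†` are scalar is zero or a multiple of a unitary. -/
theorem exists_smul_unitary {H K : Type*} [NormedAddCommGroup H] [InnerProductSpace ℂ H]
    [CompleteSpace H] [NormedAddCommGroup K] [InnerProductSpace ℂ K] [CompleteSpace K]
    {t : H →L[ℂ] K} (ht : t ≠ 0) {c d : ℂ}
    (hc : t.adjoint.comp t = c • ContinuousLinearMap.id ℂ H)
    (hd : t.comp t.adjoint = d • ContinuousLinearMap.id ℂ K) :
    ∃ r : ℂ, r ≠ 0 ∧ (r • t).adjoint.comp (r • t) = ContinuousLinearMap.id ℂ H ∧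
      (r • t).comp (r • t).adjoint = ContinuousLinearMap.id ℂ K := by
  obtain ⟨x, hx⟩ : ∃ x, t x ≠ 0 := by
    by_contra! h
    exact ht (ContinuousLinearMap.ext h)
  -- Both scalars are read off from `t t† t x`, using `t x ≠ 0`.
  have hcd : c = d := by
    have h1 : t (t.adjoint (t x)) = c • t x := by
      have := congrArg (fun s : H →L[ℂ] H => t (s x)) hc
      simpa using this
    have h2 : t (t.adjoint (t x)) = d • t x := by
      have := congrArg (fun s : K →L[ℂ] K => s (t x)) hd
      simpa using this
    exact smul_left_injective ℂ hx (h1.symm.trans h2)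
  subst hcd
  have hx0 : x ≠ 0 := by
    rintro rfl
    simp at hx
  have hn : (‖t x‖ : ℂ) ^ 2 = c * (‖x‖ : ℂ) ^ 2 := by
    have h1 : (inner ℂ (t x) (t x) : ℂ) = c * inner ℂ x x := by
      rw [← ContinuousLinearMap.adjoint_inner_right, ← inner_smul_right]
      exact congrArg (fun s : H →L[ℂ] H => inner ℂ x (s x)) hc
    rw [inner_self_eq_norm_sq_to_K, inner_self_eq_norm_sq_to_K] at h1
    exact h1
  have hx' : (‖x‖ : ℂ) ≠ 0 := by simpa using hx0
  have hx'' : (‖t x‖ : ℂ) ≠ 0 := by simpa using hx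
  -- Thus `c` is a positive real, and dividing `t` by its square root `ρ` gives a unitary.
  have hc' : c = ((‖t x‖ / ‖x‖ : ℝ) : ℂ) ^ 2 := by
    push_cast
    field_simp
    exact hn.symm
  set ρ : ℝ := ‖t x‖ / ‖x‖ with hρ
  have hρ0 : (ρ : ℂ) ≠ 0 := by
    rw [hρ]
    push_cast
    exact div_ne_zero hx'' hx'
  have e : (ρ : ℂ)⁻¹ * ((ρ : ℂ)⁻¹ * c) = 1 := by
    rw [hc']
    field_simp
  have hstar : (starRingEnd ℂ) ((ρ : ℂ)⁻¹) = (ρ : ℂ)⁻¹ := by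
    rw [map_inv₀, Complex.conj_ofReal]
  refine ⟨(ρ : ℂ)⁻¹, inv_ne_zero hρ0, ?_, ?_⟩
  · rw [map_smulₛₗ, hstar, ContinuousLinearMap.smul_comp, ContinuousLinearMap.comp_smul, hc,
      smul_smul, smul_smul, mul_assoc, e, one_smul]
  · rw [map_smulₛₗ, hstar, ContinuousLinearMap.smul_comp, ContinuousLinearMap.comp_smul, hd,
      smul_smul, smul_smul, mul_assoc, e, one_smul]

theorem adjoint_id_comp_id (H : Type*) [NormedAddCommGroup H] [InnerProductSpace ℂ H]
    [CompleteSpace H] : (ContinuousLinearMap.id ℂ H).adjoint.comp (ContinuousLinearMap.id ℂ H) =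
      ContinuousLinearMap.id ℂ H := by
  rw [ContinuousLinearMap.adjoint_id, ContinuousLinearMap.id_comp]

theorem id_comp_adjoint_id (H : Type*) [NormedAddCommGroup H] [InnerProductSpace ℂ H]
    [CompleteSpace H] : (ContinuousLinearMap.id ℂ H).comp (ContinuousLinearMap.id ℂ H).adjoint =
      ContinuousLinearMap.id ℂ H := by
  rw [ContinuousLinearMap.adjoint_id, ContinuousLinearMap.id_comp]

/-! ### Functions given by unitaries. -/

/-- The relation given by a family of operators `u i` from the atoms of `X` to atoms of `Y`. -/
noncomputable def ofUnitary (f : X.At → Y.At) (u : ∀ i, X.atom i →L[ℂ] Y.atom (f i)) :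
    QRel X Y := fun i k =>
  (one Y (f i) k).comap
    (ContinuousLinearMap.precomp (Y.atom k) (u i).adjoint :
      (X.atom i →L[ℂ] Y.atom k) →L[ℂ] (Y.atom (f i) →L[ℂ] Y.atom k)).toLinearMap

section ofUnitary

variable {f : X.At → Y.At} {u : ∀ i, X.atom i →L[ℂ] Y.atom (f i)}

/-- For unitary `u i` the relation is `ℂ · u i` at `(i, f i)` and zero at other atoms; testing `t (u
i)†` against the identity relation says this without a cast along `f i = k`. -/
theorem mem_ofUnitary {i k} {t : X.atom i →L[ℂ] Y.atom k} :
    t ∈ ofUnitary f u i k ↔ t.comp (u i).adjoint ∈ one Y (f i) k := Iff.rfl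

/-- Since `t = (t u†) u`, composing with unitaries only relabels atoms. This serves to compare two
composites with a given `F`. -/
theorem mem_comp_ofUnitary (h₁ : ∀ i, (u i).adjoint.comp (u i) = ContinuousLinearMap.id ℂ _)
    (h₂ : ∀ i, (u i).comp (u i).adjoint = ContinuousLinearMap.id ℂ _)
    (S : QRel Y Z) {i k} {t : X.atom i →L[ℂ] Z.atom k} :
    t ∈ comp S (ofUnitary f u) i k ↔ t.comp (u i).adjoint ∈ S (f i) k := by
  constructor
  · intro ht
    induction ht using Submodule.span_induction with
    | mem t ht =>
      obtain ⟨j, s, hs, r, hr, rfl⟩ := ht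
      have := comp_mem hs (mem_ofUnitary.1 hr)
      rwa [comp_one] at this
    | zero => simp
    | add x y _ _ hx hy => simpa using add_mem hx hy
    | smul a x _ hx => simpa using Submodule.smul_mem _ a hx
  · intro ht
    have e : t = (t.comp (u i).adjoint).comp (u i) := by
      rw [ContinuousLinearMap.comp_assoc, h₁, ContinuousLinearMap.comp_id]
    rw [e]
    refine comp_mem ht ?_
    rw [mem_ofUnitary, h₂]
    exact id_mem_one _

end ofUnitary

end QRel

namespace QFun

open CategoryTheory

variable {X Y Z : QSet.{u}}

/-- The function given by a family of unitaries `u i` from the atoms of `X` to atoms of `Y`. -/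
noncomputable def ofUnitary (f : X.At → Y.At) (u : ∀ i, X.atom i →L[ℂ] Y.atom (f i))
    (h₁ : ∀ i, (u i).adjoint.comp (u i) = ContinuousLinearMap.id ℂ _)
    (h₂ : ∀ i, (u i).comp (u i).adjoint = ContinuousLinearMap.id ℂ _) : QFun X Y where
  rel := QRel.ofUnitary f u
  cosurj := QRel.one_le.2 fun i => by
    have hu : u i ∈ QRel.ofUnitary f u i (f i) := by
      rw [QRel.mem_ofUnitary, h₂]
      exact QRel.id_mem_one _
    rw [← h₁ i]
    exact QRel.comp_mem (QRel.mem_adj.2 (by simpa using hu)) hu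
  coinj := QRel.comp_le.2 fun k i l s hs r hr => by
    rw [QRel.mem_adj, QRel.mem_ofUnitary] at hr
    rw [QRel.mem_ofUnitary] at hs
    -- The adjoint of `hr`; then `s r = (s u†)(u r)` lies in `I ∘ I = I`.
    have hr' : (u i).comp r ∈ QRel.one Y k (f i) := by
      rw [← QRel.adj_one, QRel.mem_adj, ContinuousLinearMap.adjoint_comp]
      exact hr
    have h := QRel.comp_mem hs hr'
    rw [QRel.comp_one] at h
    have e : (s.comp (u i).adjoint).comp ((u i).comp r) =
        s.comp (((u i).adjoint.comp (u i)).comp r) := rfl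
    rwa [e, h₁, ContinuousLinearMap.id_comp] at h

/-! ### Contravariance and faithfulness of `F ↦ F^⋆`. -/

theorem adjoint_comp_pullback (F : QFun X Y) (b : Y.Ell) {i : X.At} {j : Y.At}
    {v : X.atom i →L[ℂ] Y.atom j} (hv : v ∈ F.rel i j) :
    v.adjoint.comp (b j) = (F.pullback b i).comp v.adjoint := by
  have h := congrArg ContinuousLinearMap.adjoint (F.pullback_spec (star b) hv)
  rw [map_star, ContinuousLinearMap.adjoint_comp, ContinuousLinearMap.adjoint_comp] at h
  simpa [ContinuousLinearMap.star_eq_adjoint] using h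

theorem pullback_eq {F : QFun X Y} {b : Y.Ell} {i : X.At} {a : X.atom i →L[ℂ] X.atom i}
    (ha : ∀ j, ∀ v ∈ F.rel i j, (b j).comp v = v.comp a) : F.pullback b i = a :=
  pullbackAt_unique ha

theorem pullbackInf_apply (F : QFun X Y) (b : Y.EllInf) (i : X.At) :
    F.pullbackInf b i = F.pullback b i := rfl

theorem pullback_comp (F : X ⟶ Y) (G : Y ⟶ Z) (c : Z.Ell) :
    QFun.pullback (F ≫ G) c = QFun.pullback F (QFun.pullback G c) := by
  funext i
  refine pullback_eq fun k v hv => ?_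
  change v ∈ QRel.comp (QFun.rel G) (QFun.rel F) i k at hv
  induction hv using Submodule.span_induction with
  | mem t ht =>
    obtain ⟨j, s, hs, r, hr, rfl⟩ := ht
    calc (c k).comp (s.comp r) = ((c k).comp s).comp r := rfl
      _ = s.comp ((QFun.pullback G c j).comp r) := by rw [QFun.pullback_spec G c hs]; rfl
      _ = _ := by rw [QFun.pullback_spec F _ hr]; rfl
  | zero => simp
  | add x y _ _ hx hy => simp [ContinuousLinearMap.add_comp, hx, hy]
  | smul a x _ hx => simp [ContinuousLinearMap.smul_comp, hx]

/-- Truncating to `S` gives a finitely supported, hence bounded, family. This is the density of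
`ℓ^∞(Y)` in `ℓ(Y)` in the form used for faithfulness. -/
theorem exists_bounded_eqOn (b : Y.Ell) (S : Finset Y.At) :
    ∃ c : Y.EllInf, ∀ j ∈ S, c j = b j := by
  classical
  have h : Memℓp (fun j => if j ∈ S then b j else 0) ⊤ := by
    refine (memℓp_zero (S.finite_toSet.subset fun j hj => ?_)).of_exponent_ge le_top
    by_contra h
    exact hj (if_neg h)
  exact ⟨⟨_, h⟩, fun j hj => if_pos hj⟩

/-- A function is determined by the action of `F^⋆` on bounded families. -/
theorem rel_le_of_pullbackInf_eq {F G : QFun X Y}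
    (h : ∀ b : Y.EllInf, F.pullback b = G.pullback b) : F.rel ≤ G.rel := by
  classical
  intro i j v hv
  rw [mem_rel_iff]
  intro b
  obtain ⟨κ, _, l, p, w, -, hw, hd⟩ := G.exists_decomp i
  -- `G^⋆(b)(i)` depends only on the finitely many `b (l k)`, and the other side of the intertwining
  -- equation only on `b j`.
  obtain ⟨c, hc⟩ := exists_bounded_eqOn b (insert j (Finset.univ.image l))
  have e : G.pullback b i = G.pullback c i := by
    rw [eq_sum hd G hw fun _ _ hu => G.pullback_spec b hu,
      eq_sum hd G hw fun _ _ hu => G.pullback_spec c hu]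
    refine Finset.sum_congr rfl fun k _ => ?_
    rw [hc (l k) (by simp)]
  rw [e, ← h, ← F.pullback_spec c hv, hc j (by simp)]

theorem starHom_comp (F : X ⟶ Y) (G : Y ⟶ Z) :
    QFun.starHom (F ≫ G) = QFun.starHom G ≫ QFun.starHom F := by
  refine MStar.Hom.ext (StarAlgHom.ext fun c => X.repEquiv.symm.injective ?_)
  refine lp.ext (funext fun i => ?_)
  change X.repEquiv.symm (QFun.starAux (F ≫ G) c) i =
    X.repEquiv.symm (QFun.starAux F (QFun.starAux G c)) i
  rw [symm_starAux, symm_starAux, pullback_comp]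
  exact congrArg (fun b => QFun.pullback F b i) (funext fun j => (symm_starAux G c j).symm)

/-- A function is the relation of all intertwiners of its `F^⋆`, and bounded families suffice to
test intertwining. -/
theorem starHom_injective {F G : X ⟶ Y} (h : QFun.starHom F = QFun.starHom G) : F = G := by
  have h' : ∀ b : Y.EllInf, QFun.pullback F b = QFun.pullback G b := by
    intro b
    funext i
    have h1 : QFun.starAux F (Y.repEquiv b) = QFun.starAux G (Y.repEquiv b) :=
      congrArg (fun φ : MStar.Hom _ _ => φ.toStarAlgHom (Y.repEquiv b)) h
    have h2 := congrArg (fun a => X.repEquiv.symm a i) h1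
    simpa [symm_starAux] using h2
  exact QFun.ext (le_antisymm (rel_le_of_pullbackInf_eq h')
    (rel_le_of_pullbackInf_eq fun b => (h' b).symm))

/-! ### Injective functions and surjectivity of `F^⋆`. -/

theorem adjoint_comp_mem_one {F : QFun X Y} (h : QRel.Injective F.rel) {i k : X.At} {j : Y.At}
    {v : X.atom i →L[ℂ] Y.atom j} {w : X.atom k →L[ℂ] Y.atom j} (hv : v ∈ F.rel i j)
    (hw : w ∈ F.rel k j) : w.adjoint.comp v ∈ QRel.one X i k :=
  h _ _ (QRel.comp_mem (QRel.mem_adj.2 (by simpa using hw)) hv)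

theorem comp_adjoint_mem_one (F : QFun X Y) {i : X.At} {j l : Y.At}
    {v : X.atom i →L[ℂ] Y.atom j} {w : X.atom i →L[ℂ] Y.atom l} (hv : v ∈ F.rel i j)
    (hw : w ∈ F.rel i l) : v.comp w.adjoint ∈ QRel.one Y l j :=
  F.coinj _ _ (QRel.comp_mem hv (QRel.mem_adj.2 (by simpa using hw)))

theorem exists_unitary_mem {F : QFun X Y} (h : QRel.Injective F.rel) {i : X.At} {j : Y.At}
    {v : X.atom i →L[ℂ] Y.atom j} (hv : v ∈ F.rel i j) (hv0 : v ≠ 0) :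
    ∃ u ∈ F.rel i j, u.adjoint.comp u = ContinuousLinearMap.id ℂ _ ∧
      u.comp u.adjoint = ContinuousLinearMap.id ℂ _ := by
  obtain ⟨c, hc⟩ := QRel.mem_one_self.1 (adjoint_comp_mem_one h hv hv)
  obtain ⟨d, hd⟩ := QRel.mem_one_self.1 (F.comp_adjoint_mem_one hv hv)
  obtain ⟨r, -, h1, h2⟩ := QRel.exists_smul_unitary hv0 hc hd
  exact ⟨r • v, Submodule.smul_mem _ _ hv, h1, h2⟩

/-- A preimage of `a` is built at each atom `j` of `Y` separately: conjugate `a i` by a unitary in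
`F(i, j)` if some `F(i, j)` is nonzero. Conjugation does not increase the norm, so the result is
bounded. -/
theorem surjective_pullbackInf {F : QFun X Y} (h : QRel.Injective F.rel) :
    Function.Surjective F.pullbackInf := by
  classical
  intro a
  have key : ∀ j, ∃ b : Y.atom j →L[ℂ] Y.atom j, ‖b‖ ≤ ‖a‖ ∧
      ∀ i, ∀ v ∈ F.rel i j, b.comp v = v.comp (a i) := by
    intro j
    by_cases hj : ∃ i, ∃ v ∈ F.rel i j, v ≠ 0
    · obtain ⟨i, v, hv, hv0⟩ := hj
      obtain ⟨w, hw, h1, h2⟩ := exists_unitary_mem h hv hv0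
      have hn : ‖w‖ ≤ 1 := by
        have h3 := ContinuousLinearMap.norm_adjoint_comp_self w
        rw [h1] at h3
        have h4 := ContinuousLinearMap.norm_id_le (𝕜 := ℂ) (E := X.atom i)
        nlinarith [norm_nonneg w]
      refine ⟨w.comp ((a i).comp w.adjoint), ?_, fun k t ht => ?_⟩
      · have hn' : ‖w.adjoint‖ ≤ 1 := by rwa [LinearIsometryEquiv.norm_map]
        calc ‖w.comp ((a i).comp w.adjoint)‖ ≤ ‖w‖ * (‖a i‖ * ‖w.adjoint‖) :=
              (ContinuousLinearMap.opNorm_comp_le _ _).trans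
                (mul_le_mul_of_nonneg_left (ContinuousLinearMap.opNorm_comp_le _ _)
                  (norm_nonneg _))
          _ ≤ 1 * (‖a i‖ * 1) := by gcongr
          _ ≤ ‖a‖ := by simpa using QSet.norm_proj_le a i
      · have h3 := QRel.mul_eq_mul_of_mem_one (adjoint_comp_mem_one h ht hw) (a : X.Ell)
        calc (w.comp ((a i).comp w.adjoint)).comp t
            = w.comp ((a i).comp (w.adjoint.comp t)) := rfl
          _ = (w.comp w.adjoint).comp (t.comp (a k)) := by rw [h3]; rfl
          _ = _ := by rw [h2, ContinuousLinearMap.id_comp]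
    · push Not at hj
      -- Nothing in `F` reaches `j`, so any value would intertwine; zero respects the bound.
      refine ⟨0, by simp, fun i v hv => ?_⟩
      rw [hj i v hv]
      simp
  choose b hb hbv using key
  refine ⟨⟨b, memℓp_infty ⟨‖a‖, ?_⟩⟩, lp.ext (funext fun i => ?_)⟩
  · rintro _ ⟨j, rfl⟩
    exact hb j
  · exact pullback_eq fun j v hv => hbv j i v hv

/-! ### Formal implications. -/

/-- `F† ∘ F = I`, so `F` cancels on the left among all relations; `F†` itself need not be a
function. -/
theorem mono_of_injective {F : X ⟶ Y} (h : QRel.Injective (QFun.rel F)) :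
    Mono F := by
  have h1 : QRel.comp (QRel.adj (QFun.rel F)) (QFun.rel F) = QRel.one X :=
    le_antisymm h (QFun.cosurj F)
  refine ⟨fun {W} G H e => QFun.ext ?_⟩
  have h2 : QRel.comp (QFun.rel F) (QFun.rel G) = QRel.comp (QFun.rel F) (QFun.rel H) :=
    congrArg QFun.rel e
  rw [← QRel.one_comp (QFun.rel G), ← QRel.one_comp (QFun.rel H), ← h1, QRel.comp_assoc, h2,
    ← QRel.comp_assoc]

theorem epi_of_surjective {F : X ⟶ Y} (h : QRel.Surjective (QFun.rel F)) :
    Epi F := by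
  have h1 : QRel.comp (QFun.rel F) (QRel.adj (QFun.rel F)) = QRel.one Y :=
    le_antisymm (QFun.coinj F) h
  refine ⟨fun {Z} G H e => QFun.ext ?_⟩
  have h2 : QRel.comp (QFun.rel G) (QFun.rel F) = QRel.comp (QFun.rel H) (QFun.rel F) :=
    congrArg QFun.rel e
  rw [← QRel.comp_one (QFun.rel G), ← QRel.comp_one (QFun.rel H), ← h1, ← QRel.comp_assoc, h2,
    QRel.comp_assoc]

/-- A faithful contravariant functor reflects epis to monos. -/
theorem mono_of_epi_starHom {F : X ⟶ Y} (h : Epi (QFun.starHom F)) :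
    Mono F := by
  refine ⟨fun {W} G H e => starHom_injective ?_⟩
  rw [← cancel_epi (QFun.starHom F), ← starHom_comp, ← starHom_comp, e]

theorem epi_of_mono_starHom {F : X ⟶ Y} (h : Mono (QFun.starHom F)) :
    Epi F := by
  refine ⟨fun {Z} G H e => starHom_injective ?_⟩
  rw [← cancel_mono (QFun.starHom F), ← starHom_comp, ← starHom_comp, e]

theorem epi_starHom {F : X ⟶ Y} (h : Function.Surjective (QFun.pullbackInf F)) :
    Epi (QFun.starHom F) := by
  refine ⟨fun {A} φ ψ e => MStar.Hom.ext (StarAlgHom.ext fun a => ?_)⟩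
  obtain ⟨b, hb⟩ := h (X.repEquiv.symm a)
  have hb' : QFun.starAux F (Y.repEquiv b) = a := by
    apply X.repEquiv.symm.injective
    refine lp.ext (funext fun i => ?_)
    change X.repEquiv.symm (QFun.starAux F (Y.repEquiv b)) i = X.repEquiv.symm a i
    rw [symm_starAux, StarAlgEquiv.symm_apply_apply, ← hb, pullbackInf_apply]
  have h1 := congrArg (fun χ : MStar.Hom _ _ => χ.toStarAlgHom (Y.repEquiv b)) e
  change MStar.Hom.toStarAlgHom φ (QFun.starAux F (Y.repEquiv b)) =
    MStar.Hom.toStarAlgHom ψ (QFun.starAux F (Y.repEquiv b)) at h1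
  rwa [hb'] at h1

theorem mono_starHom {F : X ⟶ Y} (h : Function.Injective (QFun.pullbackInf F)) :
    Mono (QFun.starHom F) := by
  refine ⟨fun {A} φ ψ e => MStar.Hom.ext (StarAlgHom.ext fun a => ?_)⟩
  have h1 := congrArg (fun χ : MStar.Hom _ _ => χ.toStarAlgHom a) e
  change QFun.starAux F (MStar.Hom.toStarAlgHom φ a) =
    QFun.starAux F (MStar.Hom.toStarAlgHom ψ a) at h1
  apply Y.repEquiv.symm.injective
  apply h
  refine lp.ext (funext fun i => ?_)
  exact (symm_starAux F _ i).symm.trans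
    ((congrArg (fun c => X.repEquiv.symm c i) h1).trans (symm_starAux F _ i))

/-! ### Surjective functions, injectivity of `F^⋆`, and epis. -/

/-- If `F^⋆(b) = 0`, then `b j` annihilates every operator of `F` into `j`, hence all of `(F ∘
F†)(j, j)`, which contains the identity. -/
theorem injective_pullbackInf {F : QFun X Y} (h : QRel.Surjective F.rel) :
    Function.Injective F.pullbackInf := by
  rw [injective_iff_map_eq_zero]
  intro b hb
  refine lp.ext (funext fun j => ?_)
  have hz : ∀ i, F.pullback b i = 0 := fun i => congrArg (fun a : X.EllInf => a i) hb
  have key : ∀ t ∈ QRel.comp F.rel (QRel.adj F.rel) j j, (b j).comp t = 0 := by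
    intro t ht
    induction ht using Submodule.span_induction with
    | mem t ht =>
      obtain ⟨i, s, hs, r, -, rfl⟩ := ht
      rw [← ContinuousLinearMap.comp_assoc, F.pullback_spec b hs, hz]
      simp
    | zero => simp
    | add x y _ _ hx hy => simp [hx, hy]
    | smul a x _ hx => simp [hx]
  simpa using! key _ (QRel.one_le.1 h j)

/-- Coinjectivity makes `v v†` a scalar, nonzero by the C*-identity, so a multiple of it is the
identity of the atom. -/
theorem surjective_of_exists_ne_zero {F : QFun X Y}
    (h : ∀ j, ∃ i, ∃ v ∈ F.rel i j, v ≠ 0) : QRel.Surjective F.rel := by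
  refine QRel.one_le.2 fun j => ?_
  obtain ⟨i, v, hv, hv0⟩ := h j
  obtain ⟨c, hc⟩ := QRel.mem_one_self.1 (F.comp_adjoint_mem_one hv hv)
  have hc0 : c ≠ 0 := by
    rintro rfl
    rw [zero_smul] at hc
    have h1 := ContinuousLinearMap.norm_adjoint_comp_self v.adjoint
    rw [ContinuousLinearMap.adjoint_adjoint, hc, LinearIsometryEquiv.norm_map] at h1
    exact hv0 (by simpa using h1)
  have e : ContinuousLinearMap.id ℂ (Y.atom j) = c⁻¹ • v.comp v.adjoint := by
    rw [hc, smul_smul, inv_mul_cancel₀ hc0, one_smul]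
  rw [e]
  exact Submodule.smul_mem _ _ (QRel.comp_mem hv (QRel.mem_adj.2 (by simpa using hv)))

/-- The quantum set in which each atom of `Y` occurs twice. -/
def _root_.QSet.double (Y : QSet.{u}) : QSet.{u} where
  At := Y.At × Bool
  atom p := Y.atom p.1

/-- A function from `Y` to its double that sends each atom to one of its two copies. -/
noncomputable def toDouble (Y : QSet.{u}) (g : Y.At → Bool) : QFun Y Y.double :=
  ofUnitary (Y := Y.double) (fun j => (j, g j)) (fun j => ContinuousLinearMap.id ℂ (Y.atom j))
    (fun j => QRel.adjoint_id_comp_id (Y.atom j)) (fun j => QRel.id_comp_adjoint_id (Y.atom j))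

theorem mem_toDouble {g : Y.At → Bool} {j : Y.At} {k : Y.double.At}
    {t : Y.atom j →L[ℂ] Y.double.atom k} :
    t ∈ (toDouble Y g).rel j k ↔ t ∈ QRel.one Y.double (j, g j) k := by
  change t.comp (ContinuousLinearMap.id ℂ (Y.atom j)).adjoint ∈ QRel.one Y.double (j, g j) k ↔ _
  rw [ContinuousLinearMap.adjoint_id]
  rfl

/-- An atom `j` not reached by `F` can be sent to either copy in the double without changing the
composite with `F`. -/
theorem surjective_of_epi {F : X ⟶ Y} (h : Epi F) :
    QRel.Surjective (QFun.rel F) := by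
  classical
  refine surjective_of_exists_ne_zero fun j => ?_
  by_contra! hj
  let g : Y.At → Bool := fun l => decide (l = j)
  have hle : ∀ g₁ g₂ : Y.At → Bool, (∀ l, l ≠ j → g₁ l = g₂ l) →
      QRel.comp (toDouble Y g₁).rel (QFun.rel F) ≤ QRel.comp (toDouble Y g₂).rel (QFun.rel F) := by
    intro g₁ g₂ hg
    refine QRel.comp_le.2 fun i l k s hs r hr => ?_
    obtain rfl | hl := eq_or_ne l j
    · rw [hj i r hr]
      simp
    · refine QRel.comp_mem ?_ hr
      rw [mem_toDouble] at hs ⊢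
      rwa [← hg l hl]
  have e : F ≫ (toDouble Y g : Y ⟶ Y.double) = F ≫ (toDouble Y fun _ => false : Y ⟶ Y.double) :=
    QFun.ext (le_antisymm (hle _ _ fun l hl => by simp [g, hl])
      (hle _ _ fun l hl => by simp [g, hl]))
  have e' : toDouble Y g = toDouble Y fun _ => false := (cancel_epi F).1 e
  have h1 : ContinuousLinearMap.id ℂ (Y.atom j) ∈ (toDouble Y fun _ => false).rel j (j, false) :=
    mem_toDouble.2 (QRel.id_mem_one (X := Y.double) (j, false))
  rw [← e'] at h1
  -- Equality of the two maps would put the identity of `j` in an off-diagonal block of the identity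
  -- relation, making it zero on a nonzero space.
  have hne : ((j, g j) : Y.double.At) ≠ (j, false) := fun h => by
    simpa [g] using congrArg Prod.snd h
  replace h1 := (QRel.mem_one_ne hne).1 (mem_toDouble.1 h1)
  obtain ⟨y, hy⟩ := exists_ne (0 : Y.atom j)
  exact hy (congrArg (fun t : Y.atom j →L[ℂ] Y.atom j => t y) h1)

/-! ### Intertwiners, and injectivity of monos. -/

/-- The quantum set with a single atom, which is the atom `i` of `X`. -/
def _root_.QSet.single (X : QSet.{u}) (i : X.At) : QSet.{u} where
  At := PUnit
  atom _ := X.atom i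

/-- `t` intertwines the representations of `ℓ(Y)` on the atoms `i` and `k` of `X`. -/
def Intertwines (F : QFun X Y) {i k : X.At} (t : X.atom i →L[ℂ] X.atom k) : Prop :=
  ∀ b : Y.Ell, (F.pullback b k).comp t = t.comp (F.pullback b i)

theorem Intertwines.adjoint {F : QFun X Y} {i k : X.At} {t : X.atom i →L[ℂ] X.atom k}
    (h : F.Intertwines t) : F.Intertwines t.adjoint := by
  intro b
  have h1 := congrArg ContinuousLinearMap.adjoint (h (star b))
  rw [map_star, ContinuousLinearMap.adjoint_comp, ContinuousLinearMap.adjoint_comp] at h1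
  simpa [ContinuousLinearMap.star_eq_adjoint] using h1.symm

theorem Intertwines.comp {F : QFun X Y} {i k l : X.At} {s : X.atom k →L[ℂ] X.atom l}
    {t : X.atom i →L[ℂ] X.atom k} (hs : F.Intertwines s) (ht : F.Intertwines t) :
    F.Intertwines (s.comp t) := by
  intro b
  rw [← ContinuousLinearMap.comp_assoc, hs b, ContinuousLinearMap.comp_assoc, ht b]
  rfl

/-- `F(i, j)` consists of all intertwiners from `i` to `j`, so it absorbs precomposition by
intertwiners. -/
theorem Intertwines.comp_mem {F : QFun X Y} {i k : X.At} {t : X.atom i →L[ℂ] X.atom k}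
    (h : F.Intertwines t) {j : Y.At} {v : X.atom k →L[ℂ] Y.atom j} (hv : v ∈ F.rel k j) :
    v.comp t ∈ F.rel i j := by
  rw [mem_rel_iff]
  intro b
  rw [← ContinuousLinearMap.comp_assoc, F.pullback_spec b hv, ContinuousLinearMap.comp_assoc, h b]
  rfl

/-- The inclusion `G` of the atom `i` and the map `H` taking it to `k` along `w` have the same
composite with `F`, because `w` and `w†` intertwine. Monicity gives `G = H`; as `w` belongs to `H`,
it belongs to `G`, which means that it lies in the identity relation. -/
theorem mem_one_of_mono_of_unitary {F : X ⟶ Y} (hF : Mono F) {i k : X.At}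
    {w : X.atom i →L[ℂ] X.atom k} (hw : QFun.Intertwines F w)
    (h₁ : w.adjoint.comp w = ContinuousLinearMap.id ℂ _)
    (h₂ : w.comp w.adjoint = ContinuousLinearMap.id ℂ _) : w ∈ QRel.one X i k := by
  let G : X.single i ⟶ X := ofUnitary (X := X.single i) (fun _ => i)
    (fun _ => ContinuousLinearMap.id ℂ (X.atom i)) (fun _ => QRel.adjoint_id_comp_id (X.atom i))
    (fun _ => QRel.id_comp_adjoint_id (X.atom i))
  let H : X.single i ⟶ X := ofUnitary (X := X.single i) (fun _ => k)
    (fun _ => w) (fun _ => h₁) (fun _ => h₂)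
  have e : G ≫ F = H ≫ F := by
    refine QFun.ext (funext fun p => funext fun j => ?_)
    ext t
    refine (QRel.mem_comp_ofUnitary (X := X.single i) (fun _ => QRel.adjoint_id_comp_id (X.atom i))
    (fun _ => QRel.id_comp_adjoint_id (X.atom i)) _).trans
      (Iff.trans ?_
      (QRel.mem_comp_ofUnitary (X := X.single i) (fun _ => h₁) (fun _ => h₂) _).symm)
    change t.comp (ContinuousLinearMap.id ℂ (X.atom i)).adjoint ∈ QFun.rel F i j ↔
      (t : X.atom i →L[ℂ] Y.atom j).comp w.adjoint ∈ QFun.rel F k j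
    rw [ContinuousLinearMap.adjoint_id]
    constructor
    · intro ht
      exact hw.adjoint.comp_mem ht
    · intro ht
      have h4 : (t : X.atom i →L[ℂ] Y.atom j).comp (w.adjoint.comp w) ∈ QFun.rel F i j :=
        hw.comp_mem ht
      rw [h₁] at h4
      exact h4
  have e' : G = H := (cancel_mono F).1 e
  have h3 : w ∈ (QFun.rel H) PUnit.unit k := by
    change w.comp w.adjoint ∈ QRel.one X k k
    rw [h₂]
    exact QRel.id_mem_one k
  rw [← e'] at h3
  change w.comp (ContinuousLinearMap.id ℂ (X.atom i)).adjoint ∈ QRel.one X i k at h3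
  rw [ContinuousLinearMap.adjoint_id] at h3
  exact h3

theorem mem_one_self_of_mono {F : X ⟶ Y} (hF : Mono F) {i : X.At}
    {t : X.atom i →L[ℂ] X.atom i} (ht : QFun.Intertwines F t) : t ∈ QRel.one X i i := by
  let S : StarSubalgebra ℂ (X.atom i →L[ℂ] X.atom i) :=
    StarSubalgebra.centralizer ℂ (Set.range fun b => QFun.pullback F b i)
  have hS : ∀ s, s ∈ S ↔ QFun.Intertwines F s := by
    intro s
    rw [StarSubalgebra.mem_centralizer_iff]
    constructor
    · intro h b
      exact (h _ ⟨b, rfl⟩).1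
    · rintro h _ ⟨b, rfl⟩
      -- The star centralizer also asks for commutation with adjoints; these are the values of `F^⋆`
      -- at `star b`.
      refine ⟨h b, ?_⟩
      rw [← Pi.star_apply, ← map_star]
      exact h (star b)
  -- Closedness makes the commutant `S` a C*-algebra, so that it is spanned by its unitaries.
  have : IsClosed (S : Set (X.atom i →L[ℂ] X.atom i)) :=
    (Subalgebra.toSubmodule S.toSubalgebra).closed_of_finiteDimensional
  have hspan : (⟨t, (hS t).2 ht⟩ : S) ∈ Submodule.span ℂ (unitary S : Set S) := by
    rw [CStarAlgebra.span_unitary]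
    trivial
  have key : ∀ s ∈ Submodule.span ℂ (unitary S : Set S),
      (s : X.atom i →L[ℂ] X.atom i) ∈ QRel.one X i i := by
    intro s hs
    induction hs using Submodule.span_induction with
    | mem s hs =>
      obtain ⟨h1, h2⟩ := Unitary.mem_iff.1 hs
      exact mem_one_of_mono_of_unitary hF ((hS _).1 s.2) (congrArg Subtype.val h1)
        (congrArg Subtype.val h2)
    | zero => exact zero_mem _
    | add x y _ _ hx hy => exact add_mem hx hy
    | smul a x _ hx => exact Submodule.smul_mem _ a hx
  exact key _ hspan

/-- The generators `s r` of `F† ∘ F` are intertwiners. The self-intertwiners `t† t` and `t t†` are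
scalar, which reduces a nonzero `t` to the unitary case up to a nonzero factor. -/
theorem injective_of_mono {F : X ⟶ Y} (hF : Mono F) :
    QRel.Injective (QFun.rel F) := by
  refine QRel.comp_le.2 fun i j k s hs r hr => ?_
  have ht : QFun.Intertwines F (s.comp r) := by
    intro b
    have h1 := QFun.adjoint_comp_pullback F b (QRel.mem_adj.1 hs)
    rw [ContinuousLinearMap.adjoint_adjoint] at h1
    rw [← ContinuousLinearMap.comp_assoc, ← h1, ContinuousLinearMap.comp_assoc,
      QFun.pullback_spec F b hr]
    rfl
  generalize s.comp r = t at ht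
  by_cases ht0 : t = 0
  · rw [ht0]
    exact zero_mem _
  obtain ⟨c, hc⟩ := QRel.mem_one_self.1 (mem_one_self_of_mono hF (ht.adjoint.comp ht))
  obtain ⟨d, hd⟩ := QRel.mem_one_self.1 (mem_one_self_of_mono hF (ht.comp ht.adjoint))
  obtain ⟨a, ha, h1, h2⟩ := QRel.exists_smul_unitary ht0 hc hd
  have hat : QFun.Intertwines F (a • t) := by
    intro b
    rw [ContinuousLinearMap.comp_smul, ContinuousLinearMap.smul_comp, ht b]
  exact (Submodule.smul_mem_iff _ ha).1 (mem_one_of_mono_of_unitary hF hat h1 h2)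

end QFun

/-! ### The two equivalences. -/

theorem mainTheorem12 {X Y : QSet.{u}} (F : X ⟶ Y) :
    List.TFAE
      [QRel.Injective (QFun.rel F),
        CategoryTheory.Mono F,
        CategoryTheory.Epi (QFun.starHom F),
        Function.Surjective (QFun.pullbackInf F : Y.EllInf → X.EllInf)] ∧
    List.TFAE
      [QRel.Surjective (QFun.rel F),
        CategoryTheory.Epi F,
        CategoryTheory.Mono (QFun.starHom F),
        Function.Injective (QFun.pullbackInf F : Y.EllInf → X.EllInf)] := by
  refine ⟨?_, ?_⟩
  · tfae_have 1 → 2 := QFun.mono_of_injective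
    tfae_have 2 → 1 := QFun.injective_of_mono
    tfae_have 1 → 4 := QFun.surjective_pullbackInf
    tfae_have 4 → 3 := QFun.epi_starHom
    tfae_have 3 → 2 := QFun.mono_of_epi_starHom
    tfae_finish
  · tfae_have 1 → 2 := QFun.epi_of_surjective
    tfae_have 2 → 1 := QFun.surjective_of_epi
    tfae_have 1 → 4 := QFun.injective_pullbackInf
    tfae_have 4 → 3 := QFun.mono_starHom
    tfae_have 3 → 2 := QFun.epi_of_mono_starHom
    tfae_finish
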